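/- A game graph $G=\langle V,V_0,V_1,E\rangle$ consists of a finite directed graph $(V,E)$ in which every vertex has at least one successor, and a partition $V=V_0\uplus V_1$ into vertices of Player 0 and of Player 1. A cofair game graph $G^{cf}=(G,E^f)$ has in addition a set of fair edges $E^f\subseteq E\cap(V_0\times V)$; write $E(v)$, $E^f(v)$ for the sets of successors and of fair successors of $v$, and $V^f=\{v\mid E^f(v)\neq\emptyset\}$. A play is an infinite path $\xi$; $\mathrm{Inf}(\xi)$ is the set of vertices it visits infinitely often. It is fair if for every $v\in V^f\cap\mathrm{Inf}(\xi)$ we have $E^f(v)\subseteq\mathrm{Inf}(\xi)$. For $B\subseteq V$, Player 0 wins a play $\xi$ of the (plain) coBüchi game $\langle G,\overline{\mathsf{Inf}}(B)\rangle$ iff $\mathrm{Inf}(\xi)\cap B=\emptyset$, and wins a play $\xi$ of the cofair coBüchi game $\langle G^{cf},\overline{\mathsf{Inf}}(B)\rangle$ iff $\mathrm{Inf}(\xi)\cap B=\emptyset$ and $\xi$ is fair; Player 1 wins all other plays. A strategy of Player $j$ chooses, depending on the finite history, a successor of the current vertex whenever that vertex is in $V_j$; $\mathsf{Win}_j$ is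 the set of vertices $v$ for which Player $j$ has a strategy such that Player $j$ wins all plays from $v$ that are consistent with it. **Theorem.** Let $\langle G^{cf},\overline{\mathsf{Inf}}(B)\rangle$ be a cofair coBüchi game with $G^{cf}=(G,E^f)$, $G=\langle V,V_0,V_1,E\rangle$. Let $\langle G',\overline{\mathsf{Inf}}(B')\rangle$, $G'=\langle V',V_0',V_1',E'\rangle$, be the plain coBüchi game with $$V'=V\cup\{v_l,v_r\mid v\in V^f\setminus B\},\qquad B'=B\cup\{v_r\mid v\in V^f\setminus B\}$$ (where all $v_l,v_r$ are new, pairwise distinct vertices), where vertices of $V$ keep their owner, every $v_l$ belongs to Player 1 and every $v_r$ to Player 0, and $$E'(v)=\begin{cases}\{v_l,v_r\}& v\in V^f\setminus B,\\ E(v)& v\in V\setminus(V^f\setminus B),\end{cases}\qquad E'(v_l)=E^f(v),\qquad E'(v_r)=E(v).$$ Then $V'$ is finite, $|V'|=|V|+2\,|V^f\setminus B|$, $|B'|=|B|+|V^f\setminus B|$, and for both $j\in\{0,1\}$ $$\mathsf{Win}_j(G^{cf},\overline{\mathsf{Inf}}(B))=\mathsf{Win}_j(G',\overline{\mathsf{Inf}}(B'))\cap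 V.$$ -/

import Mathlib

open Filter

/-- A game graph on the vertex set `V`. The vertices are partitioned between the players by `owner`:
`V₀ = {v | owner v = 0}` and `V₁ = {v | owner v = 1}`. Every vertex has a successor. -/
structure GameGraph (V : Type*) where
  owner : V → Fin 2
  E : V → V → Prop
  exists_succ : ∀ v, ∃ w, E v w

/-- A game graph with fair edges, all of which originate from vertices of Player 0. -/
structure CofairGameGraph (V : Type*) extends GameGraph V where
  Ef : V → V → Prop
  Ef_sub : ∀ {v w}, Ef v w → E v w
  owner_of_Ef : ∀ {v w}, Ef v w → owner v = 0

/-- The set of vertices visited infinitely often by a sequence of vertices. -/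
def infVisited {V : Type*} (ξ : ℕ → V) : Set V :=
  {v | ∃ᶠ i in atTop, ξ i = v}

/-- The coBüchi specification: no vertex of `B` is visited infinitely often. -/
def coBuchi {V : Type*} (B : Set V) : Set (ℕ → V) :=
  {ξ | ∀ v ∈ B, v ∉ infVisited ξ}

namespace GameGraph

variable {V : Type*} (G : GameGraph V)

/-- A strategy of Player `j`: given the history `h` before the current vertex `v` (owned by `j`),
it selects a successor of `v`. -/
structure Strategy (j : Fin 2) where
  move : List V → {v : V // G.owner v = j} → V
  move_edge : ∀ (h : List V) (v : {v : V // G.owner v = j}), G.E v.1 (move h v)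

/-- A play: an infinite path in the game graph. -/
def IsPlay (ξ : ℕ → V) : Prop :=
  ∀ i, G.E (ξ i) (ξ (i + 1))

variable {G} in
/-- A play that is consistent with the strategy `σ` of Player `j`;
the history at time `i` is `ξ 0, …, ξ (i - 1)`. -/
def Strategy.IsStrategyPlay {j : Fin 2} (σ : G.Strategy j) (ξ : ℕ → V) : Prop :=
  G.IsPlay ξ ∧
    ∀ (i : ℕ) (hi : G.owner (ξ i) = j), ξ (i + 1) = σ.move ((List.range i).map ξ) ⟨ξ i, hi⟩

/-- `W` is the set of plays won by Player 0; all other plays are won by Player 1. -/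
def WonBy (W : Set (ℕ → V)) (j : Fin 2) (ξ : ℕ → V) : Prop :=
  if j = 0 then ξ ∈ W else ξ ∉ W

/-- The winning region of Player `j` in the (non-fair) game on `G`
in which Player 0 wins exactly the plays in `W`. -/
def win (W : Set (ℕ → V)) (j : Fin 2) : Set V :=
  {v | ∃ σ : G.Strategy j, ∀ ξ, σ.IsStrategyPlay ξ → ξ 0 = v → WonBy W j ξ}

end GameGraph

/-- Vertices of the gadget game: the old vertices, together with two new vertices `v_l`, `v_r`
for every `v ∈ S`. -/
inductive GadgetVertex {V : Type*} (S : Set V) where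
  | base (v : V)
  | left (v : S)
  | right (v : S)

namespace CofairGameGraph

variable {V : Type*} (G : CofairGameGraph V)

/-- The set of fair vertices. -/
def fairVertices : Set V :=
  {v | ∃ w, G.Ef v w}

/-- The fair sequences: if a fair vertex is visited infinitely often, then so are all its fair
successors. -/
def fairPlays : Set (ℕ → V) :=
  {ξ | ∀ v ∈ G.fairVertices, v ∈ infVisited ξ → ∀ w, G.Ef v w → w ∈ infVisited ξ}

/-- The winning region of Player `j` in the cofair game with specification `Φ`: Player 0 wins a play
iff it satisfies `Φ` and is fair. -/
def cofairWin (Φ : Set (ℕ → V)) (j : Fin 2) : Set V :=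
  G.toGameGraph.win (Φ ∩ G.fairPlays) j

/-- The fair vertices that get replaced by a gadget with two new vertices. -/
def gadgetBase (B : Set V) : Set V :=
  G.fairVertices \ B

/-- Edges of the gadget game. -/
inductive GadgetEdge (B : Set V) :
    GadgetVertex (G.gadgetBase B) → GadgetVertex (G.gadgetBase B) → Prop
  | regular {v w : V} (hv : v ∉ G.gadgetBase B) (h : G.E v w) : GadgetEdge B (.base v) (.base w)
  | toLeft (v : G.gadgetBase B) : GadgetEdge B (.base v) (.left v)
  | toRight (v : G.gadgetBase B) : GadgetEdge B (.base v) (.right v)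
  | ofLeft (v : G.gadgetBase B) {w : V} (h : G.Ef v w) : GadgetEdge B (.left v) (.base w)
  | ofRight (v : G.gadgetBase B) {w : V} (h : G.E v w) : GadgetEdge B (.right v) (.base w)

/-- The (non-fair) game graph of the gadget game. -/
def gadgetGraph (B : Set V) : GameGraph (GadgetVertex (G.gadgetBase B)) where
  owner
    | .base v => G.owner v
    | .left _ => 1
    | .right _ => 0
  E := G.GadgetEdge B
  exists_succ := by
    rintro (v | v | v)
    · by_cases hv : v ∈ G.gadgetBase B
      · exact ⟨_, .toLeft ⟨v, hv⟩⟩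
      · obtain ⟨w, hw⟩ := G.exists_succ v
        exact ⟨_, .regular hv hw⟩
    · obtain ⟨w, hw⟩ := v.2.1
      exact ⟨_, .ofLeft v hw⟩
    · obtain ⟨w, hw⟩ := G.exists_succ v
      exact ⟨_, .ofRight v hw⟩

/-- The coBüchi vertices of the gadget game. -/
def gadgetCoBuchi (B : Set V) : Set (GadgetVertex (G.gadgetBase B)) :=
  GadgetVertex.base '' B ∪ Set.range GadgetVertex.right

end CofairGameGraph

/-! Both winning regions are certified by rankings. Player 0's rank never rises and drops after each
visit to `B`; at a vertex of Player 0 where no drop is chosen, all fair edges keep the rank from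
rising, so they can be taken in rotation. Player 1's rank measures the distance to `B` when Player 0
has to be fair. By `exists_complementary_rankings` the two kinds of certificate cover `V` with a set
`W` and its complement.

The gadget encodes the two options of Player 0's ranking: `v_r`, a coBüchi vertex, promises a drop,
and `v_l` lets Player 1 pick any fair edge. Hence both rankings transfer to the gadget game (the two
`exists_gadget` lemmas). That game is a cofair game without fair edges, so the same soundness lemmas
`subset_cofairWin` apply to it. As no vertex is won by both players, `W` and its complement
determine the winners among the old vertices in both games. -/

namespace GameGraph

variable {V : Type*} {G : GameGraph V}

/-- Any two strategies of the two players have a common play from every vertex. -/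
theorem Strategy.exists_common_play (σ : G.Strategy 0) (τ : G.Strategy 1) (v : V) :
    ∃ ξ, σ.IsStrategyPlay ξ ∧ τ.IsStrategyPlay ξ ∧ ξ 0 = v := by
  classical
  have owner_one : ∀ u, ¬ G.owner u = 0 → G.owner u = 1 := fun u hu => by omega
  let next : List V → V → V := fun h u =>
    if hu : G.owner u = 0 then σ.move h ⟨u, hu⟩ else τ.move h ⟨u, owner_one u hu⟩
  let state : ℕ → List V × V := fun n =>
    Nat.rec ([], v) (fun _ p => (p.1 ++ [p.2], next p.1 p.2)) n
  let ξ : ℕ → V := fun n => (state n).2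
  have history : ∀ n, (state n).1 = (List.range n).map ξ := by
    intro n
    induction n with
    | zero => rfl
    | succ n ih =>
      rw [List.range_succ, List.map_append, ← ih]
      rfl
  have succ_eq : ∀ n, ξ (n + 1) = next ((List.range n).map ξ) (ξ n) := by
    intro n
    rw [← history]
  have zero_eq : ∀ n (hn : G.owner (ξ n) = 0),
      ξ (n + 1) = σ.move ((List.range n).map ξ) ⟨ξ n, hn⟩ := by
    intro n hn
    rw [succ_eq]
    exact dif_pos hn
  have one_eq : ∀ n (hn : G.owner (ξ n) = 1),
      ξ (n + 1) = τ.move ((List.range n).map ξ) ⟨ξ n, hn⟩ := by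
    intro n hn
    rw [succ_eq]
    exact dif_neg (by omega)
  have play : G.IsPlay ξ := by
    intro n
    by_cases hn : G.owner (ξ n) = 0
    · rw [zero_eq n hn]
      exact σ.move_edge _ ⟨ξ n, hn⟩
    · rw [one_eq n (owner_one _ hn)]
      exact τ.move_edge _ ⟨ξ n, owner_one _ hn⟩
  exact ⟨ξ, ⟨play, zero_eq⟩, ⟨play, one_eq⟩, rfl⟩

/-- No vertex is winning for both players. -/
theorem not_mem_win_one_of_mem_win_zero {W : Set (ℕ → V)} {v : V} (h₀ : v ∈ G.win W 0) :
    v ∉ G.win W 1 := by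
  rintro ⟨τ, hτ⟩
  obtain ⟨σ, hσ⟩ := h₀
  obtain ⟨ξ, hξσ, hξτ, hv⟩ := σ.exists_common_play τ v
  have h0 : ξ ∈ W := by simpa [WonBy] using hσ ξ hξσ hv
  have h1 : ξ ∉ W := by simpa [WonBy] using hτ ξ hξτ hv
  exact h1 h0

end GameGraph

/-! ### Recurrence in infinite sequences -/

/-- A countable nonempty set can be enumerated with every element occurring infinitely often. -/
theorem Set.Countable.exists_frequently_eq {α : Type*} {s : Set α} (hs : s.Countable)
    (hne : s.Nonempty) : ∃ f : ℕ → α, (∀ n, f n ∈ s) ∧ ∀ a ∈ s, ∃ᶠ n in atTop, f n = a := by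
  obtain ⟨e, rfl⟩ := hs.exists_eq_range hne
  -- The first component of the inverse pairing function takes every value infinitely often.
  refine ⟨fun n => e n.unpair.1, fun n => ⟨_, rfl⟩, ?_⟩
  rintro _ ⟨k, rfl⟩
  rw [Filter.frequently_atTop]
  intro N
  exact ⟨Nat.pair k N, Nat.right_le_pair k N, by simp⟩

theorem List.count_map_range_eq_nat_count {α : Type*} [DecidableEq α] (ξ : ℕ → α) (v : α) (n : ℕ) :
    ((List.range n).map ξ).count v = Nat.count (fun i => ξ i = v) n := by
  induction n with
  | zero => simp
  | succ n ih =>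
    rw [List.range_succ, List.map_append, List.count_append, ih, Nat.count_succ]
    simp [List.count_singleton]

/-- If at its `n`-th visit to `v` a sequence moves to `f n`, and it visits `v` infinitely often,
then it visits every recurring value of `f` infinitely often. -/
theorem mem_infVisited_of_count {V : Type*} [DecidableEq V] {ξ : ℕ → V} {v w : V} {f : ℕ → V}
    (hv : v ∈ infVisited ξ)
    (hf : ∀ i, ξ i = v → ξ (i + 1) = f (((List.range i).map ξ).count v))
    (hw : ∃ᶠ n in atTop, f n = w) : w ∈ infVisited ξ := by
  have hinf : {i | ξ i = v}.Infinite := Nat.frequently_atTop_iff_infinite.1 hv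
  refine Filter.frequently_atTop.2 fun N => ?_
  obtain ⟨n, hn, hnw⟩ := Filter.frequently_atTop.1 hw N
  refine ⟨Nat.nth (fun i => ξ i = v) n + 1, ?_, ?_⟩
  · have := (Nat.nth_strictMono hinf).le_apply (x := n)
    omega
  · rw [hf _ (Nat.nth_mem_of_infinite hinf n), List.count_map_range_eq_nat_count,
      Nat.count_nth_of_infinite hinf, hnw]

/-- In a finite type, a vertex visited infinitely often has a recurring successor. -/
theorem exists_frequently_succ {V : Type*} [Finite V] {ξ : ℕ → V} {p : ℕ → Prop}
    (hp : ∃ᶠ i in atTop, p i) : ∃ w, ∃ᶠ i in atTop, p i ∧ ξ i = w := by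
  by_contra h
  simp only [not_exists, Filter.not_frequently] at h
  obtain ⟨i, hi, hi'⟩ := (hp.and_eventually (Filter.eventually_all.2 h)).exists
  exact hi' (ξ i) ⟨hi, rfl⟩

theorem mem_infVisited_of_frequently_succ {V : Type*} {ξ : ℕ → V} {w : V}
    (h : ∃ᶠ i in atTop, ξ (i + 1) = w) : w ∈ infVisited ξ :=
  (Filter.tendsto_add_atTop_nat 1).frequently h

/-! ### Rankings and their soundness -/

namespace CofairGameGraph

variable {V : Type*} (G : CofairGameGraph V) (B : Set V)

/-- A ranking witnessing that Player 0 wins the cofair coBüchi game from `W`: ranks never increase,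
strictly decrease after visits to `B`, and every vertex of Player 0 whose rank cannot be decreased
by a move keeps its rank along all fair edges. -/
structure IsRankingZero (W : Set V) (s : V → ℕ) : Prop where
  zero : ∀ v ∈ W, G.owner v = 0 → (∃ w, G.E v w ∧ w ∈ W ∧ s w < s v) ∨
    (v ∉ B ∧ (∃ w, G.E v w ∧ w ∈ W ∧ s w ≤ s v) ∧ ∀ w, G.Ef v w → w ∈ W ∧ s w ≤ s v)
  one : ∀ v ∈ W, G.owner v = 1 → ∀ w, G.E v w → w ∈ W ∧ s w ≤ s v ∧ (v ∈ B → s w < s v)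

/-- A ranking witnessing that Player 1 can force progress towards `B` within `D`, provided that
Player 0 plays fairly. -/
structure IsAttractorRanking (D : Set V) (r : V → ℕ) : Prop where
  zero : ∀ v ∈ D, G.owner v = 0 → v ∉ B → (∀ w, G.E v w → w ∈ D ∧ r w < r v) ∨
    ∃ w, G.Ef v w ∧ w ∈ D ∧ r w < r v
  one : ∀ v ∈ D, G.owner v = 1 → v ∉ B → ∃ w, G.E v w ∧ w ∈ D ∧ r w < r v

/-- A ranking witnessing that Player 1 wins the cofair coBüchi game from `C`. -/
structure IsRankingOne (C : Set V) (r : V → ℕ) : Prop extends G.IsAttractorRanking B C r where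
  closed_zero : ∀ v ∈ C, G.owner v = 0 → ∀ w, G.E v w → w ∈ C
  closed_one : ∀ v ∈ C, G.owner v = 1 → ∃ w, G.E v w ∧ w ∈ C

variable {G B}

/-- Supplies the moves of Player 0's strategy: `f n` is to be played at the `n`-th visit to `v`, so
recurring values of `f` become recurring successors. -/
theorem IsRankingZero.exists_moves [Countable V] {W : Set V} {s : V → ℕ}
    (h : G.IsRankingZero B W s) (v : {v // G.owner v = 0}) :
    ∃ f : ℕ → V, (∀ n, G.E v (f n)) ∧ (v.1 ∈ W →
      (∀ n, f n ∈ W ∧ s (f n) < s v) ∨ (v.1 ∉ B ∧ (∀ n, f n ∈ W ∧ s (f n) ≤ s v) ∧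
        ∀ w, G.Ef v w → ∃ᶠ n in atTop, f n = w)) := by
  by_cases hv : v.1 ∈ W
  · rcases h.zero v hv v.2 with ⟨w, hw, hwW, hws⟩ | ⟨hB, ⟨w, hw, hwW⟩, hf⟩
    · exact ⟨fun _ => w, fun _ => hw, fun _ => .inl fun _ => ⟨hwW, hws⟩⟩
    · by_cases hfair : ({w | G.Ef v w} : Set V).Nonempty
      · obtain ⟨f, hf₁, hf₂⟩ := (Set.to_countable {w | G.Ef v w}).exists_frequently_eq hfair
        exact ⟨f, fun n => G.Ef_sub (hf₁ n), fun _ => .inr ⟨hB, fun n => hf _ (hf₁ n), hf₂⟩⟩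
      · exact ⟨fun _ => w, fun _ => hw, fun _ => .inr ⟨hB, fun _ => hwW,
          fun w' hw' => (hfair ⟨w', hw'⟩).elim⟩⟩
  · obtain ⟨w, hw⟩ := G.exists_succ v
    exact ⟨fun _ => w, fun _ => hw, fun hv' => (hv hv').elim⟩

/-- Ranks are eventually constant along a play, so a recurring vertex has no strict drop: it lies
outside `B`, and if it belongs to Player 0 its fair edges are taken in rotation. -/
theorem IsRankingZero.subset_cofairWin [Countable V] {W : Set V} {s : V → ℕ}
    (h : G.IsRankingZero B W s) : W ⊆ G.cofairWin (coBuchi B) 0 := by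
  classical
  choose f hfE hf using h.exists_moves
  intro v₀ hv₀
  refine ⟨⟨fun l v => f v (l.count v.1), fun l v => hfE v _⟩, ?_⟩
  rintro ξ ⟨hplay, hσ⟩ rfl
  replace hσ : ∀ (i : ℕ) (hi : G.owner (ξ i) = 0),
    ξ (i + 1) = f ⟨ξ i, hi⟩ (((List.range i).map ξ).count (ξ i)) := hσ
  have step : ∀ i, ξ i ∈ W → ξ (i + 1) ∈ W ∧ s (ξ (i + 1)) ≤ s (ξ i) := by
    intro i hi
    by_cases h0 : G.owner (ξ i) = 0
    · rw [hσ i h0]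
      rcases hf ⟨ξ i, h0⟩ hi with hlt | hle
      · exact ⟨(hlt _).1, (hlt _).2.le⟩
      · exact hle.2.1 _
    · have := h.one _ hi (by omega) _ (hplay i)
      exact ⟨this.1, this.2.1⟩
  have hW : ∀ i, ξ i ∈ W := fun i => Nat.rec hv₀ (fun i hi => (step i hi).1) i
  have hanti : Antitone fun i => s (ξ i) := antitone_nat_of_succ_le fun i => (step i (hW i)).2
  obtain ⟨N, hN⟩ := WellFoundedLT.antitone_chain_condition hanti
  replace hN : ∀ m, N ≤ m → s (ξ N) = s (ξ m) := hN
  have hstable : ∀ v, v ∈ infVisited ξ → ∃ i, ξ i = v ∧ s (ξ (i + 1)) = s (ξ i) := by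
    intro v hv
    obtain ⟨i, hi, hiv⟩ := Filter.frequently_atTop.1 hv N
    exact ⟨i, hiv, by rw [← hN i hi, ← hN (i + 1) (by omega)]⟩
  have hzero : ∀ v (h0 : G.owner v = 0), v ∈ infVisited ξ →
      v ∉ B ∧ ∀ w, G.Ef v w → ∃ᶠ n in atTop, f ⟨v, h0⟩ n = w := by
    intro v h0 hv
    obtain ⟨i, rfl, hi⟩ := hstable v hv
    rcases hf ⟨ξ i, h0⟩ (hW i) with hlt | hle
    · have := (hlt (((List.range i).map ξ).count (ξ i))).2
      rw [← hσ i h0] at this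
      exact absurd hi this.ne
    · exact ⟨hle.1, hle.2.2⟩
  refine ⟨?_, ?_⟩
  · intro v hvB hv
    by_cases h0 : G.owner v = 0
    · exact (hzero v h0 hv).1 hvB
    · obtain ⟨i, rfl, hi⟩ := hstable v hv
      exact ((h.one _ (hW i) (by omega) _ (hplay i)).2.2 hvB).ne hi
  · rintro v ⟨u, hu⟩ hv w hw
    have h0 := G.owner_of_Ef hu
    refine mem_infVisited_of_count (f := f ⟨v, h0⟩) hv ?_ ((hzero v h0 hv).2 w hw)
    rintro i rfl
    exact hσ i h0

/-- If Player 0 won, a recurring vertex of least rank would lie outside `B`, and a recurring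
successor, or a fair successor that fairness makes recur, would have smaller rank. Player 1 needs
only a positional strategy. -/
theorem IsRankingOne.subset_cofairWin [Finite V] {C : Set V} {r : V → ℕ}
    (h : G.IsRankingOne B C r) : C ⊆ G.cofairWin (coBuchi B) 1 := by
  classical
  have hmove : ∀ v : {v // G.owner v = 1}, ∃ w, G.E v w ∧
      (v.1 ∈ C → w ∈ C ∧ (v.1 ∉ B → r w < r v)) := by
    intro v
    by_cases hv : v.1 ∈ C
    · by_cases hB : v.1 ∈ B
      · obtain ⟨w, hw, hwC⟩ := h.closed_one v hv v.2
        exact ⟨w, hw, fun _ => ⟨hwC, fun hB' => (hB' hB).elim⟩⟩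
      · obtain ⟨w, hw, hwC, hwr⟩ := h.one v hv v.2 hB
        exact ⟨w, hw, fun _ => ⟨hwC, fun _ => hwr⟩⟩
    · obtain ⟨w, hw⟩ := G.exists_succ v
      exact ⟨w, hw, fun hv' => (hv hv').elim⟩
  choose f hfE hf using hmove
  intro v₀ hv₀
  refine ⟨⟨fun _ v => f v, fun _ v => hfE v⟩, ?_⟩
  rintro ξ ⟨hplay, hσ⟩ rfl
  replace hσ : ∀ (i : ℕ) (hi : G.owner (ξ i) = 1), ξ (i + 1) = f ⟨ξ i, hi⟩ := hσ
  suffices ¬ (ξ ∈ coBuchi B ∩ G.fairPlays) by simpa [GameGraph.WonBy] using this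
  rintro ⟨hcoB, hfair⟩
  have hC : ∀ i, ξ i ∈ C := by
    intro i
    induction i with
    | zero => exact hv₀
    | succ i hi =>
      by_cases h1 : G.owner (ξ i) = 1
      · rw [hσ i h1]
        exact (hf ⟨ξ i, h1⟩ hi).1
      · exact h.closed_zero _ hi (by omega) _ (hplay i)
  have hne : (infVisited ξ).Nonempty := by
    obtain ⟨w, hw⟩ := exists_frequently_succ (ξ := ξ) (p := fun _ => True)
      ((Filter.frequently_true_iff_neBot _).2 inferInstance)
    exact ⟨w, hw.mono fun i hi => hi.2⟩
  obtain ⟨v, hv, hmin⟩ := (infVisited ξ).toFinite.exists_minimalFor r _ hne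
  replace hmin : ∀ w ∈ infVisited ξ, ¬ r w < r v := fun w hw hlt =>
    absurd (hmin hw hlt.le) (not_le.2 hlt)
  have hvB : v ∉ B := fun hB => hcoB v hB hv
  obtain ⟨w, hw⟩ := exists_frequently_succ (ξ := fun i => ξ (i + 1)) hv
  have hwinf : w ∈ infVisited ξ := mem_infVisited_of_frequently_succ (hw.mono fun i hi => hi.2)
  obtain ⟨i, rfl, rfl⟩ := hw.exists
  by_cases h1 : G.owner (ξ i) = 1
  · refine hmin _ hwinf ?_
    rw [hσ i h1]
    exact (hf ⟨ξ i, h1⟩ (hC i)).2 hvB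
  · rcases h.zero _ (hC i) (by omega) hvB with hall | ⟨u, hu, -, hur⟩
    · exact hmin _ hwinf (hall _ (hplay i)).2
    · exact hmin u (hfair _ ⟨u, hu⟩ hv u hu) hur

/-! ### Extending rankings, and determinacy -/

/-- A ranking for Player 0 extends to vertices from which Player 0 can stay outside `B` or move to
ranked vertices. -/
theorem IsRankingZero.exists_union [Finite V] {W : Set V} {s : V → ℕ}
    (h : G.IsRankingZero B W s) {Y : Set V}
    (hzero : ∀ v ∈ Y, G.owner v = 0 → (∃ w, G.E v w ∧ w ∈ W) ∨
      (v ∉ B ∧ (∃ w, G.E v w ∧ w ∈ W ∪ Y) ∧ ∀ w, G.Ef v w → w ∈ W ∪ Y))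
    (hone : ∀ v ∈ Y, G.owner v = 1 → ∀ w, G.E v w → w ∈ W ∪ Y ∧ (v ∈ B → w ∈ W)) :
    ∃ s', G.IsRankingZero B (W ∪ Y) s' := by
  classical
  obtain ⟨M, hM⟩ := (Set.finite_range s).bddAbove
  replace hM : ∀ v, s v ≤ M := fun v => hM ⟨v, rfl⟩
  -- One fresh rank above all others: entering `W` is a strict drop, staying in `Y` is neutral.
  let s' : V → ℕ := fun v => if v ∈ W then s v else M + 1
  have hs' : ∀ v, v ∈ W → s' v = s v := fun v hv => if_pos hv
  have hs'Y : ∀ v, v ∉ W → s' v = M + 1 := fun v hv => if_neg hv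
  have hle : ∀ v, s' v ≤ M + 1 := fun v => by
    have := hM v
    dsimp only [s']
    split_ifs <;> omega
  have hlt : ∀ v, v ∈ W → s' v < M + 1 := fun v hv => by
    have := hM v
    rw [hs' v hv]
    omega
  refine ⟨s', ?_, ?_⟩
  · intro v hv h0
    by_cases hvW : v ∈ W
    · rw [hs' v hvW]
      rcases h.zero v hvW h0 with ⟨w, hw, hwW, hws⟩ | ⟨hB, ⟨w, hw, hwW, hws⟩, hf⟩
      · exact .inl ⟨w, hw, .inl hwW, by rwa [hs' w hwW]⟩
      · refine .inr ⟨hB, ⟨w, hw, .inl hwW, by rwa [hs' w hwW]⟩, fun u hu => ?_⟩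
        obtain ⟨huW, hus⟩ := hf u hu
        exact ⟨.inl huW, by rwa [hs' u huW]⟩
    · rw [hs'Y v hvW]
      rcases hzero v (hv.resolve_left hvW) h0 with ⟨w, hw, hwW⟩ | ⟨hB, ⟨w, hw, hwY⟩, hf⟩
      · exact .inl ⟨w, hw, .inl hwW, hlt w hwW⟩
      · exact .inr ⟨hB, ⟨w, hw, hwY, hle w⟩, fun u hu => ⟨hf u hu, hle u⟩⟩
  · intro v hv h1 w hw
    by_cases hvW : v ∈ W
    · obtain ⟨hwW, hws⟩ := h.one v hvW h1 w hw
      rw [hs' v hvW, hs' w hwW]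
      exact ⟨.inl hwW, hws⟩
    · obtain ⟨hwY, hwB⟩ := hone v (hv.resolve_left hvW) h1 w hw
      rw [hs'Y v hvW]
      exact ⟨hwY, hle w, fun hB => hlt w (hwB hB)⟩

theorem IsAttractorRanking.exists_insert [Finite V] {D : Set V} {r : V → ℕ}
    (h : G.IsAttractorRanking B D r) {v : V} (hvD : v ∉ D)
    (hzero : G.owner v = 0 → v ∉ B → (∀ w, G.E v w → w ∈ D) ∨ ∃ w, G.Ef v w ∧ w ∈ D)
    (hone : G.owner v = 1 → v ∉ B → ∃ w, G.E v w ∧ w ∈ D) :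
    ∃ r', G.IsAttractorRanking B (insert v D) r' := by
  classical
  obtain ⟨M, hM⟩ := (Set.finite_range r).bddAbove
  replace hM : ∀ v, r v ≤ M := fun v => hM ⟨v, rfl⟩
  let r' : V → ℕ := fun v => if v ∈ D then r v else M + 1
  have hr' : ∀ v, v ∈ D → r' v = r v := fun v hv => if_pos hv
  have hr'v : r' v = M + 1 := if_neg hvD
  have hlt : ∀ w, w ∈ D → r' w < r' v := fun w hw => by
    have := hM w
    rw [hr' w hw, hr'v]
    omega
  refine ⟨r', ?_, ?_⟩
  · rintro u (rfl | hu) h0 hB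
    · rcases hzero h0 hB with hall | ⟨w, hw, hwD⟩
      · exact .inl fun w hw => ⟨.inr (hall w hw), hlt w (hall w hw)⟩
      · exact .inr ⟨w, hw, .inr hwD, hlt w hwD⟩
    · rw [hr' u hu]
      rcases h.zero u hu h0 hB with hall | ⟨w, hw, hwD, hwr⟩
      · refine .inl fun w hw => ?_
        obtain ⟨hwD, hwr⟩ := hall w hw
        exact ⟨.inr hwD, by rwa [hr' w hwD]⟩
      · exact .inr ⟨w, hw, .inr hwD, by rwa [hr' w hwD]⟩
  · rintro u (rfl | hu) h1 hB
    · obtain ⟨w, hw, hwD⟩ := hone h1 hB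
      exact ⟨w, hw, .inr hwD, hlt w hwD⟩
    · obtain ⟨w, hw, hwD, hwr⟩ := h.one u hu h1 hB
      exact ⟨w, hw, .inr hwD, by rwa [hr' u hu, hr' w hwD]⟩

variable (G B) in
/-- Every finite cofair coBüchi game has complementary rankings for the two players. -/
theorem exists_complementary_rankings [Finite V] :
    ∃ (W : Set V) (s r : V → ℕ), G.IsRankingZero B W s ∧ G.IsRankingOne B Wᶜ r := by
  obtain ⟨W, ⟨s, hs⟩, hWmax⟩ := (Set.toFinite {W : Set V | ∃ s, G.IsRankingZero B W s}).exists_maximal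
    ⟨∅, fun _ => 0, by constructor <;> simp⟩
  obtain ⟨D, ⟨hDW, r, hr⟩, hDmax⟩ :=
    (Set.toFinite {D : Set V | D ⊆ Wᶜ ∧ ∃ r, G.IsAttractorRanking B D r}).exists_maximal
      ⟨∅, by simp, fun _ => 0, by constructor <;> simp⟩
  have hW : ∀ Y : Set V, Y.Nonempty → Y ⊆ Wᶜ → ¬ ∃ s', G.IsRankingZero B (W ∪ Y) s' := by
    rintro Y ⟨y, hy⟩ hYW hex
    exact hYW hy (hWmax hex Set.subset_union_left (.inr hy))
  have hD : ∀ v, v ∉ W → v ∉ D → ¬ ∃ r', G.IsAttractorRanking B (insert v D) r' := by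
    intro v hvW hvD hex
    exact hvD (hDmax ⟨Set.insert_subset hvW hDW, hex⟩ (Set.subset_insert _ _)
      (Set.mem_insert _ _))
  have hDeq : D = Wᶜ := by
    by_contra hne
    -- No vertex left over can join `D`, so all of them lie outside `B` and Player 0 can avoid `D`
    -- from them, even along all fair edges. They could then join `W`, against its maximality.
    have hY : (Wᶜ \ D).Nonempty := Set.nonempty_of_ssubset (hDW.ssubset_of_ne hne)
    have hmem : ∀ w, w ∉ D → w ∈ W ∪ (Wᶜ \ D) := fun w hw => by
      by_cases hwW : w ∈ W
      · exact .inl hwW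
      · exact .inr ⟨hwW, hw⟩
    refine hW _ hY Set.sdiff_subset (hs.exists_union ?_ ?_)
    · rintro v ⟨hvW, hvD⟩ h0
      by_contra! hno
      refine hD v hvW hvD (hr.exists_insert hvD ?_ (by omega))
      intro _ hB
      by_contra! hno'
      obtain ⟨⟨w, hw, hwD⟩, hf⟩ := hno'
      obtain ⟨u, hu, hu'⟩ := hno.2 hB ⟨w, hw, hmem w hwD⟩
      exact hu' (hmem u (hf u hu))
    · rintro v ⟨hvW, hvD⟩ h1 w hw
      by_contra! hno
      refine hD v hvW hvD (hr.exists_insert hvD (by omega) ?_)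
      intro _ hB
      by_contra! hno'
      exact hB (hno (hmem w (hno' w hw))).1
  subst hDeq
  refine ⟨W, s, r, hs, hr, ?_, ?_⟩
  -- Closure of `Wᶜ` also follows from maximality: a violating vertex could be added to `W` on its
  -- own.
  · intro v hv h0 w hw hwW
    refine hW {v} ⟨v, rfl⟩ (by simpa using hv) (hs.exists_union ?_ ?_)
    · rintro _ rfl -
      exact .inl ⟨w, hw, hwW⟩
    · rintro _ rfl h1
      omega
  · intro v hv h1
    by_contra! hno
    refine hW {v} ⟨v, rfl⟩ (by simpa using hv) (hs.exists_union ?_ ?_)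
    · rintro _ rfl h0
      omega
    · rintro _ rfl - w hw
      have hwW : w ∈ W := not_not.1 (hno w hw)
      exact ⟨.inl hwW, fun _ => hwW⟩

/-! ### Transfer of rankings to the gadget game -/

variable (G B) in
/-- The gadget game graph, as a cofair game graph without fair edges. -/
def gadgetCofair : CofairGameGraph (GadgetVertex (G.gadgetBase B)) where
  toGameGraph := G.gadgetGraph B
  Ef _ _ := False
  Ef_sub := False.elim
  owner_of_Ef := False.elim

variable (G B) in
theorem gadgetCofair_cofairWin (Φ : Set (ℕ → GadgetVertex (G.gadgetBase B))) (j : Fin 2) :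
    (G.gadgetCofair B).cofairWin Φ j = (G.gadgetGraph B).win Φ j := by
  have : (G.gadgetCofair B).fairPlays = Set.univ :=
    Set.eq_univ_of_forall fun ξ v _ _ w hw => hw.elim
  rw [cofairWin, this, Set.inter_univ]
  rfl

theorem owner_of_mem_gadgetBase {v : V} (hv : v ∈ G.gadgetBase B) : G.owner v = 0 :=
  G.owner_of_Ef hv.1.choose_spec

@[simp]
theorem base_mem_gadgetCoBuchi {v : V} : .base v ∈ G.gadgetCoBuchi B ↔ v ∈ B := by
  simp [gadgetCoBuchi]

@[simp]
theorem left_mem_gadgetCoBuchi {v : G.gadgetBase B} : .left v ∉ G.gadgetCoBuchi B := by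
  simp [gadgetCoBuchi]

@[simp]
theorem right_mem_gadgetCoBuchi {v : G.gadgetBase B} : .right v ∈ G.gadgetCoBuchi B := by
  simp [gadgetCoBuchi]

theorem IsRankingZero.exists_gadget {W : Set V} {s : V → ℕ} (h : G.IsRankingZero B W s) :
    ∃ W' s', (G.gadgetCofair B).IsRankingZero (G.gadgetCoBuchi B) W' s' ∧
      ∀ v ∈ W, GadgetVertex.base v ∈ W' := by
  let W' : Set (GadgetVertex (G.gadgetBase B)) := {x | match x with
    | .base v => v ∈ W
    | .left v => ∀ w, G.Ef v w → w ∈ W ∧ s w ≤ s v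
    | .right v => ∃ w, G.E v w ∧ w ∈ W ∧ s w < s v}
  -- Doubling makes room for `v_r` strictly between the ranks of `v` and of all lower-ranked old
  -- vertices, so the required drop after `v_r` is exactly a drop of `s`.
  let s' : GadgetVertex (G.gadgetBase B) → ℕ := fun x => match x with
    | .base v => 2 * s v + 1
    | .left v => 2 * s v + 1
    | .right v => 2 * s v
  refine ⟨W', s', ⟨?_, ?_⟩, fun v hv => hv⟩
  · rintro (v | v | v) hv h0
    · replace hv : v ∈ W := hv
      by_cases hS : v ∈ G.gadgetBase B
      · refine .inr ⟨by simpa using hS.2, ?_, fun _ => False.elim⟩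
        rcases h.zero v hv h0 with hlt | ⟨-, -, hf⟩
        · exact ⟨_, .toRight ⟨v, hS⟩, hlt, Nat.le_succ _⟩
        · exact ⟨_, .toLeft ⟨v, hS⟩, hf, le_rfl⟩
      · rcases h.zero v hv h0 with ⟨w, hw, hwW, hws⟩ | ⟨hB, ⟨w, hw, hwW, hws⟩, hf⟩
        · exact .inl ⟨_, .regular hS hw, hwW, by dsimp only [s']; omega⟩
        · exact .inr ⟨by simpa using hB, ⟨_, .regular hS hw, hwW, by dsimp only [s']; omega⟩,
            fun _ => False.elim⟩
    · exact absurd h0 one_ne_zero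
    · obtain ⟨w, hw, hwW, hws⟩ := hv
      exact .inl ⟨_, .ofRight v hw, hwW, by dsimp only [s']; omega⟩
  · rintro (v | v | v) hv h1 x hx
    · replace h1 : G.owner v = 1 := h1
      cases hx with
      | regular hS hw =>
        obtain ⟨hwW, hws, hwB⟩ := h.one v hv h1 _ hw
        refine ⟨hwW, by dsimp only [s']; omega, fun hB => ?_⟩
        have := hwB (by simpa using hB)
        dsimp only [s']
        omega
      | toLeft v => simp [owner_of_mem_gadgetBase v.2] at h1
      | toRight v => simp [owner_of_mem_gadgetBase v.2] at h1
    · cases hx with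
      | ofLeft _ hw =>
        obtain ⟨hwW, hws⟩ := hv _ hw
        exact ⟨hwW, by dsimp only [s']; omega, fun hB => by simp at hB⟩
    · exact absurd h1 zero_ne_one

theorem IsRankingOne.exists_gadget {C : Set V} {r : V → ℕ} (h : G.IsRankingOne B C r) :
    ∃ C' r', (G.gadgetCofair B).IsRankingOne (G.gadgetCoBuchi B) C' r' ∧
      ∀ v ∈ C, GadgetVertex.base v ∈ C' := by
  let C' : Set (GadgetVertex (G.gadgetBase B)) := {x | match x with
    | .base v => v ∈ C
    | .left v => v.1 ∈ C
    | .right v => v.1 ∈ C}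
  -- Both moves from a gadget vertex `v` must drop. Rank 0 suffices for `v_r`, a coBüchi vertex and
  -- hence a target; `v_l` fits between `v` and its lower-ranked successors.
  let r' : GadgetVertex (G.gadgetBase B) → ℕ := fun x => match x with
    | .base v => 2 * r v + 1
    | .left v => 2 * r v
    | .right _ => 0
  have hleft : ∀ v : G.gadgetBase B, v.1 ∈ C → ∃ x, G.GadgetEdge B (.left v) x ∧ x ∈ C' ∧
      r' x < r' (.left v) := by
    intro v hv
    have h0 := owner_of_mem_gadgetBase v.2
    -- If all edges decrease the rank, any fair edge will do; one exists since `v` is fair.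
    obtain ⟨u, hu⟩ := v.2.1
    rcases h.zero v hv h0 v.2.2 with hall | ⟨w, hw, hwC, hwr⟩
    · obtain ⟨huC, hur⟩ := hall u (G.Ef_sub hu)
      exact ⟨_, .ofLeft v hu, huC, by dsimp only [r']; omega⟩
    · exact ⟨_, .ofLeft v hw, hwC, by dsimp only [r']; omega⟩
  refine ⟨C', r', ⟨⟨?_, ?_⟩, ?_, ?_⟩, fun v hv => hv⟩
  · rintro (v | v | v) hv h0 hB
    · refine .inl fun x hx => ?_
      cases hx with
      | regular hS hw =>
        have hvB : v ∉ B := by simpa using hB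
        rcases h.zero v hv h0 hvB with hall | ⟨u, hu, -⟩
        · obtain ⟨hwC, hwr⟩ := hall _ hw
          exact ⟨hwC, by dsimp only [r']; omega⟩
        · exact absurd ⟨⟨u, hu⟩, hvB⟩ hS
      | toLeft v => exact ⟨hv, Nat.lt_succ_self _⟩
      | toRight v => exact ⟨hv, Nat.succ_pos _⟩
    · exact absurd h0 one_ne_zero
    · simp at hB
  · rintro (v | v | v) hv h1 hB
    · replace h1 : G.owner v = 1 := h1
      have hS : v ∉ G.gadgetBase B := fun hS => by simp [owner_of_mem_gadgetBase hS] at h1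
      obtain ⟨w, hw, hwC, hwr⟩ := h.one v hv h1 (by simpa using hB)
      exact ⟨_, .regular hS hw, hwC, by dsimp only [r']; omega⟩
    · exact hleft v hv
    · exact absurd h1 zero_ne_one
  · rintro (v | v | v) hv h0 x hx
    · cases hx with
      | regular hS hw => exact h.closed_zero v hv h0 _ hw
      | toLeft v => exact hv
      | toRight v => exact hv
    · exact absurd h0 one_ne_zero
    · cases hx with
      | ofRight _ hw => exact h.closed_zero v hv (owner_of_mem_gadgetBase v.2) _ hw
  · rintro (v | v | v) hv h1
    · replace h1 : G.owner v = 1 := h1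
      have hS : v ∉ G.gadgetBase B := fun hS => by simp [owner_of_mem_gadgetBase hS] at h1
      obtain ⟨w, hw, hwC⟩ := h.closed_one v hv h1
      exact ⟨_, .regular hS hw, hwC⟩
    · obtain ⟨x, hx, hxC, -⟩ := hleft v hv
      exact ⟨x, hx, hxC⟩
    · exact absurd h1 zero_ne_one

end CofairGameGraph

/-! ### Cardinalities and the theorem -/

namespace GadgetVertex

variable {V : Type*} (S : Set V)

/-- Gadget vertices as a disjoint union. -/
def equivSum : GadgetVertex S ≃ V ⊕ S ⊕ S where
  toFun
    | base v => .inl v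
    | left v => .inr (.inl v)
    | right v => .inr (.inr v)
  invFun
    | .inl v => base v
    | .inr (.inl v) => left v
    | .inr (.inr v) => right v
  left_inv := by rintro (v | v | v) <;> rfl
  right_inv := by rintro (v | v | v) <;> rfl

instance [Finite V] : Finite (GadgetVertex S) :=
  .of_equiv _ (equivSum S).symm

theorem card_eq [Finite V] : Nat.card (GadgetVertex S) = Nat.card V + 2 * S.ncard := by
  rw [Nat.card_congr (equivSum S), Nat.card_sum, Nat.card_sum, Nat.card_coe_set_eq, two_mul]

end GadgetVertex

theorem CofairGameGraph.ncard_gadgetCoBuchi {V : Type*} [Finite V] (G : CofairGameGraph V)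
    (B : Set V) : (G.gadgetCoBuchi B).ncard = B.ncard + (G.fairVertices \ B).ncard := by
  rw [gadgetCoBuchi, Set.ncard_union_eq]
  · rw [Set.ncard_image_of_injective _ fun _ _ h => GadgetVertex.base.inj h, ← Set.image_univ,
      Set.ncard_image_of_injective _ fun _ _ h => GadgetVertex.right.inj h, Set.ncard_univ,
      Nat.card_coe_set_eq, gadgetBase]
  · rw [Set.disjoint_left]
    rintro _ ⟨v, -, rfl⟩ ⟨w, hw⟩
    cases hw

theorem mainTheorem2 {V : Type*} [Finite V] (G : CofairGameGraph V) (B : Set V) :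
    Finite (GadgetVertex (G.gadgetBase B)) ∧
    Nat.card (GadgetVertex (G.gadgetBase B)) =
      Nat.card V + 2 * (G.fairVertices \ B).ncard ∧
    (G.gadgetCoBuchi B).ncard = B.ncard + (G.fairVertices \ B).ncard ∧
    ∀ (j : Fin 2) (v : V),
      v ∈ G.cofairWin (coBuchi B) j ↔
        GadgetVertex.base v ∈ (G.gadgetGraph B).win (coBuchi (G.gadgetCoBuchi B)) j := by
  refine ⟨inferInstance, GadgetVertex.card_eq _, G.ncard_gadgetCoBuchi B, ?_⟩
  obtain ⟨W, s, r, hs, hr⟩ := G.exists_complementary_rankings B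
  obtain ⟨W', s', hs', hW'⟩ := hs.exists_gadget
  obtain ⟨C', r', hr', hC'⟩ := hr.exists_gadget
  have h₀ : ∀ v ∈ W, v ∈ G.cofairWin (coBuchi B) 0 := hs.subset_cofairWin
  have h₁ : ∀ v ∉ W, v ∈ G.cofairWin (coBuchi B) 1 := hr.subset_cofairWin
  have h₀' : ∀ v ∈ W,
      GadgetVertex.base v ∈ (G.gadgetGraph B).win (coBuchi (G.gadgetCoBuchi B)) 0 := by
    intro v hv
    rw [← CofairGameGraph.gadgetCofair_cofairWin]
    exact hs'.subset_cofairWin (hW' v hv)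
  have h₁' : ∀ v ∉ W,
      GadgetVertex.base v ∈ (G.gadgetGraph B).win (coBuchi (G.gadgetCoBuchi B)) 1 := by
    intro v hv
    rw [← CofairGameGraph.gadgetCofair_cofairWin]
    exact hr'.subset_cofairWin (hC' v hv)
  intro j v
  by_cases hv : v ∈ W
  · have hn : v ∉ G.cofairWin (coBuchi B) 1 :=
      GameGraph.not_mem_win_one_of_mem_win_zero (h₀ v hv)
    have hn' := GameGraph.not_mem_win_one_of_mem_win_zero (h₀' v hv)
    match j with
    | 0 => exact iff_of_true (h₀ v hv) (h₀' v hv)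
    | 1 => exact iff_of_false hn hn'
  · have hn : v ∉ G.cofairWin (coBuchi B) 0 := fun h =>
      GameGraph.not_mem_win_one_of_mem_win_zero h (h₁ v hv)
    have hn' := fun h => GameGraph.not_mem_win_one_of_mem_win_zero h (h₁' v hv)
    match j with
    | 0 => exact iff_of_false hn hn'
    | 1 => exact iff_of_true (h₁ v hv) (h₁' v hv)
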